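/- Let $X$ be a complex Banach space and let $(T_t)_{t\ge 0}$ be a strongly continuous semigroup of bounded linear operators on $X$ such that $\lim_{t\to+\infty}\frac{\log\|T_t\|}{t}=0$ (here $\log 0:=0$, so that the trivial case $T_t=0$ for all large $t$ is included). Let $B$ be the generator of the semigroup, with $Bx=\lim_{t\to0^+}t^{-1}(T_tx-x)$ on the domain $\mathcal D(B)$ of all $x\in X$ for which this limit exists, and put $\operatorname{Ker}B=\{x\in\mathcal D(B):Bx=0\}$ and $\operatorname{Im}B=\{Bx:x\in\mathcal D(B)\}$. Then for every $\lambda>0$ the Abel average $$\tilde A_\lambda x=\lambda\int_0^\infty e^{-\lambda s}\,T_sx\,ds\qquad(x\in X),$$ where the integral is an improper Riemann integral, is a well-defined bounded linear operator on $X$, and the following statements are equivalent: (i) $X=\operatorname{Ker}B\oplus\operatorname{Im}B$; (ii) for some $\lambda>0$, the sequence $(\tilde A_\lambda^n)_{n\in\mathbb N}$ converges in the operator norm; (iii) for every $\lambda>0$, the sequence $(\tilde A_\lambda^n)_{n\in\mathbb N}$ converges in the operator norm. Moreover, for each $\lambda>0$ for which $(\tilde A_\lambda^n)_{n\in\mathbb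 N}$ converges in the operator norm, its limit is the projection of $X$ onto $\operatorname{Ker}B$ along $\operatorname{Im}B$. -/

import Mathlib

open Filter Topology
open scoped NNReal

/-- `T` is a strongly continuous (`C₀`) one-parameter semigroup of bounded linear operators. -/
structure IsC0Semigroup {X : Type*} [NormedAddCommGroup X] [NormedSpace ℂ X]
    (T : ℝ≥0 → X →L[ℂ] X) : Prop where
  map_zero : T 0 = 1
  map_add : ∀ s t : ℝ≥0, T (s + t) = T s * T t
  continuous_orbit : ∀ x : X, Continuous fun t : ℝ≥0 => T t x

/-- `y` is the right derivative at `0` of the orbit `t ↦ T t x`. -/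
def HasOrbitDeriv {X : Type*} [NormedAddCommGroup X] [NormedSpace ℂ X]
    (T : ℝ≥0 → X →L[ℂ] X) (x y : X) : Prop :=
  Tendsto (fun t : ℝ≥0 => (t : ℝ)⁻¹ • (T t x - x)) (𝓝[>] 0) (𝓝 y)

theorem HasOrbitDeriv.add {X : Type*} [NormedAddCommGroup X] [NormedSpace ℂ X]
    {T : ℝ≥0 → X →L[ℂ] X} {x x' y y' : X} (h : HasOrbitDeriv T x y)
    (h' : HasOrbitDeriv T x' y') : HasOrbitDeriv T (x + x') (y + y') := by
  refine (Tendsto.add h h').congr fun t => ?_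
  rw [← smul_add, map_add]
  congr 1
  abel

theorem HasOrbitDeriv.smul {X : Type*} [NormedAddCommGroup X] [NormedSpace ℂ X]
    {T : ℝ≥0 → X →L[ℂ] X} {x y : X} (c : ℂ) (h : HasOrbitDeriv T x y) :
    HasOrbitDeriv T (c • x) (c • y) := by
  refine (Tendsto.const_smul h c).congr fun t => ?_
  rw [map_smul, ← smul_sub, smul_comm]

theorem HasOrbitDeriv.unique {X : Type*} [NormedAddCommGroup X] [NormedSpace ℂ X]
    {T : ℝ≥0 → X →L[ℂ] X} {x y y' : X} (h : HasOrbitDeriv T x y)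
    (h' : HasOrbitDeriv T x y') : y = y' :=
  tendsto_nhds_unique h h'

/-- The (infinitesimal) generator `B` of `T`, as an unbounded operator: its domain is the set of
all `x` for which `B x = lim_{t → 0+} (T t x - x) / t` exists. -/
noncomputable def semigroupGenerator {X : Type*} [NormedAddCommGroup X] [NormedSpace ℂ X]
    (T : ℝ≥0 → X →L[ℂ] X) : X →ₗ.[ℂ] X where
  domain :=
    { carrier := {x | ∃ y, HasOrbitDeriv T x y}
      add_mem' := fun ⟨y, hy⟩ ⟨y', hy'⟩ => ⟨y + y', hy.add hy'⟩
      zero_mem' := ⟨0, by simp [HasOrbitDeriv]⟩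
      smul_mem' := fun c _ ⟨y, hy⟩ => ⟨c • y, hy.smul c⟩ }
  toFun :=
    { toFun := fun x => Classical.choose x.2
      map_add' := fun x x' => (Classical.choose_spec (x + x').2).unique
        ((Classical.choose_spec x.2).add (Classical.choose_spec x'.2))
      map_smul' := fun c x => (Classical.choose_spec (c • x).2).unique
        ((Classical.choose_spec x.2).smul c) }

/-- The kernel `{x ∈ D(B) | B x = 0}` of an unbounded operator, as a subspace of `X`. -/
def unboundedKer {X : Type*} [NormedAddCommGroup X] [NormedSpace ℂ X]
    (B : X →ₗ.[ℂ] X) : Submodule ℂ X :=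
  (LinearMap.ker B.toFun).map B.domain.subtype

/-- The image `{B x | x ∈ D(B)}` of an unbounded operator. -/
def unboundedIm {X : Type*} [NormedAddCommGroup X] [NormedSpace ℂ X]
    (B : X →ₗ.[ℂ] X) : Submodule ℂ X :=
  LinearMap.range B.toFun

/-- The bounded operator `A` is the Abel average `l ∫₀^∞ e^{-l s} T_s ds`, the integral being
understood pointwise, as an improper integral. -/
def IsAbelAverage {X : Type*} [NormedAddCommGroup X] [NormedSpace ℂ X]
    (T : ℝ≥0 → X →L[ℂ] X) (l : ℝ) (A : X →L[ℂ] X) : Prop :=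
  ∀ x : X, Tendsto (fun b : ℝ => l • ∫ s in (0 : ℝ)..b, Real.exp (-(l * s)) • T s.toNNReal x)
    atTop (𝓝 (A x))

open Classical in
/-- The Abel average of `T` with parameter `l`. It is set to `0` if the improper integrals do not
define a bounded operator. -/
noncomputable def abelAverage {X : Type*} [NormedAddCommGroup X] [NormedSpace ℂ X]
    (T : ℝ≥0 → X →L[ℂ] X) (l : ℝ) : X →L[ℂ] X :=
  if h : ∃ A : X →L[ℂ] X, IsAbelAverage T l A then Classical.choose h else 0

/-- `P` is the projection of `X` onto `K` along `R`. -/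
structure IsProjectionOntoAlong {X : Type*} [NormedAddCommGroup X] [NormedSpace ℂ X]
    (P : X →L[ℂ] X) (K R : Submodule ℂ X) : Prop where
  idempotent : P * P = P
  range_eq : LinearMap.range (P : X →ₗ[ℂ] X) = K
  ker_eq : LinearMap.ker (P : X →ₗ[ℂ] X) = R

/-!
For `0 < re μ` the Laplace transform `R(μ) x = ∫₀^∞ exp (-μ s) T_s x ds` converges absolutely,
because `log ‖T t‖ / t → 0` makes `‖T t‖` grow slower than every exponential, and `R(μ)` is the
resolvent `(μ - B)⁻¹` of the generator (`IsC0Semigroup.exists_isGeneratorResolvent`). The Abel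
average is `A = l • R(l)`, and `1 - A = -B R(l)`. Hence `ker (1 - A) = Ker B` and
`range (1 - A) = Im B`, whatever `l` is, and everything reduces to powers of the single bounded
operator `A`.

If `A ^ n → P` in norm, then `A P = P A = P = P ^ 2`, so `(A - P) ^ n = A ^ n - P → 0`. This makes
`1 - (A - P)` invertible, and identifies `P` as the projection onto `ker (1 - A)` along
`range (1 - A)` (`isProjectionOntoAlong_of_tendsto_pow`).

Conversely, let `X = ker (1 - A) ⊕ range (1 - A)`. By the open mapping theorem the range is closed,
so the decomposition comes from a bounded projection `P`. Since the resolvent exists on the whole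
right half plane, the resolvent identity makes `z - A` invertible for `1 ≤ ‖z‖`, `z ≠ 1`
(`IsGeneratorResolvent.isUnit_algebraMap_sub`). Removing the fixed space also removes the point
`1`: the spectrum of `A - P` lies in the open unit disc, and Gelfand's formula gives
`A ^ n - P = (A - P) ^ n → 0` (`exists_tendsto_pow_of_isCompl`).
-/

/-! ### Powers of a bounded operator converging in norm -/

section Powers

variable {X : Type*} [NormedAddCommGroup X] [NormedSpace ℂ X]

theorem pow_mul_eq_self {R : Type*} [Monoid R] {a p : R} (h : a * p = p) (n : ℕ) :
    a ^ n * p = p := by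
  induction n with
  | zero => simp
  | succ n ih => rw [pow_succ, mul_assoc, h, ih]

theorem sub_pow_succ {R : Type*} [Ring R] {a p : R} (hap : a * p = p) (hpa : p * a = p)
    (hpp : p * p = p) (n : ℕ) : (a - p) ^ (n + 1) = a ^ (n + 1) - p := by
  induction n with
  | zero => simp
  | succ n ih =>
    rw [pow_succ, ih, sub_mul, mul_sub, mul_sub, pow_mul_eq_self hap, hpa, hpp, ← pow_succ]
    abel

/-- If the powers of `A` converge in operator norm, the limit is the projection onto the fixed
space `ker (1 - A)` along `range (1 - A)`. -/
theorem isProjectionOntoAlong_of_tendsto_pow [CompleteSpace X] {A P : X →L[ℂ] X}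
    (h : Tendsto (fun n : ℕ => A ^ n) atTop (𝓝 P)) :
    IsProjectionOntoAlong P (LinearMap.ker ((1 - A : X →L[ℂ] X) : X →ₗ[ℂ] X))
      (LinearMap.range ((1 - A : X →L[ℂ] X) : X →ₗ[ℂ] X)) := by
  have hsucc : Tendsto (fun n : ℕ => A ^ (n + 1)) atTop (𝓝 P) :=
    h.comp (tendsto_add_atTop_nat 1)
  have hAP : A * P = P :=
    tendsto_nhds_unique ((h.const_mul A).congr fun n => (pow_succ' A n).symm) hsucc
  have hPA : P * A = P :=
    tendsto_nhds_unique ((h.mul_const A).congr fun n => (pow_succ A n).symm) hsucc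
  have hpowP := pow_mul_eq_self hAP
  have hPP : P * P = P :=
    tendsto_nhds_unique ((h.mul_const P).congr hpowP) tendsto_const_nhds
  have hpow := sub_pow_succ hAP hPA hPP
  -- Some power of `A - P` has norm less than one, so `1 - (A - P)` is invertible.
  have hunit : IsUnit (1 - (A - P)) := by
    have hlt : ∀ᶠ n : ℕ in atTop, ‖A ^ (n + 1) - P‖ < 1 :=
      (tendsto_iff_norm_sub_tendsto_zero.1 hsucc).eventually_lt_const one_pos
    obtain ⟨n, hn⟩ := hlt.exists
    rw [← hpow] at hn
    have hu := isUnit_one_sub_of_norm_lt_one hn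
    rw [← mul_neg_geom_sum] at hu
    refine ((Commute.isUnit_mul_iff ?_).1 hu).1
    refine Commute.sum_right _ _ _ fun i _ => ?_
    exact ((Commute.one_left _).sub_left (Commute.refl _)).pow_right i
  have hP : ∀ x, P (P x) = P x := fun x => congr($hPP x)
  have hPA' : ∀ x, P (A x) = P x := fun x => congr($hPA x)
  have hAP' : ∀ x, A (P x) = P x := fun x => congr($hAP x)
  refine ⟨hPP, ?_, ?_⟩
  · ext x
    constructor
    · rintro ⟨y, rfl⟩
      simp [hAP']
    · intro hx
      have hx' : A x = x := by
        exact (sub_eq_zero.1 (LinearMap.mem_ker.1 hx)).symm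
      have hfix : ∀ n : ℕ, (A ^ n) x = x := fun n => by
        induction n with
        | zero => simp
        | succ n ih => rw [pow_succ, mul_apply_eq_comp, hx', ih]
      refine ⟨x, ?_⟩
      have hlim : Tendsto (fun n : ℕ => (A ^ n) x) atTop (𝓝 (P x)) :=
        ((ContinuousLinearMap.apply ℂ X x).continuous.tendsto P).comp h
      exact tendsto_nhds_unique hlim (by simp only [hfix]; exact tendsto_const_nhds)
  · ext x
    constructor
    · intro hx
      have hx' : P x = 0 := hx
      obtain ⟨y, rfl⟩ := (ContinuousLinearMap.isUnit_iff_bijective.1 hunit).2 x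
      have hy : P y = 0 := by simpa [hP, hPA'] using hx'
      exact ⟨y, by simp [hy]⟩
    · rintro ⟨y, rfl⟩
      simp [hPA']

/-- The range of a bounded operator whose kernel is an algebraic complement of its range is
closed: the map `(u, v) ↦ f u + v` on `X × ker f` is an open surjection, and it pulls the range
of `f` back to `X × {0}`. -/
theorem isClosed_range_of_isCompl_ker [CompleteSpace X] (f : X →L[ℂ] X)
    (h : IsCompl (LinearMap.ker (f : X →ₗ[ℂ] X)) (LinearMap.range (f : X →ₗ[ℂ] X))) :
    IsClosed (LinearMap.range (f : X →ₗ[ℂ] X) : Set X) := by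
  have hK : IsClosed (LinearMap.ker (f : X →ₗ[ℂ] X) : Set X) := f.isClosed_ker
  have : CompleteSpace (LinearMap.ker (f : X →ₗ[ℂ] X)) := hK.completeSpace_coe
  let C : X × LinearMap.ker (f : X →ₗ[ℂ] X) →L[ℂ] X :=
    f.coprod (Submodule.subtypeL _)
  have hC : ∀ p, C p = f p.1 + p.2 := fun p => by simp [C]
  have hsurj : Function.Surjective C := fun x => by
    obtain ⟨v, hv, w, ⟨u, rfl⟩, rfl⟩ :=
      Submodule.mem_sup.1 (h.sup_eq_top ▸ Submodule.mem_top (x := x))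
    exact ⟨(u, ⟨v, hv⟩), by rw [hC]; exact add_comm _ _⟩
  rw [← (C.isQuotientMap hsurj).isClosed_preimage]
  have hpre : C ⁻¹' (LinearMap.range (f : X →ₗ[ℂ] X) : Set X) = {p | p.2 = 0} := by
    ext p
    simp only [Set.mem_preimage, hC, SetLike.mem_coe, Set.mem_ofPred_eq]
    constructor
    · rintro ⟨w, hw⟩
      refine Subtype.ext ((Submodule.disjoint_def.1 h.disjoint) _ p.2.2 ⟨w - p.1, ?_⟩)
      rw [map_sub, hw]
      simp
    · intro hp
      exact ⟨p.1, by simp [hp]⟩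
  rw [hpre]
  exact isClosed_eq continuous_snd continuous_const

/-- An operator whose spectrum lies in the open unit disc has powers tending to zero. -/
theorem tendsto_pow_zero_of_isUnit_algebraMap_sub [CompleteSpace X] {D : X →L[ℂ] X}
    (h : ∀ z : ℂ, 1 ≤ ‖z‖ → IsUnit (algebraMap ℂ (X →L[ℂ] X) z - D)) :
    Tendsto (fun n : ℕ => D ^ n) atTop (𝓝 0) := by
  rcases subsingleton_or_nontrivial X with hX | hX
  · have : ∀ n : ℕ, D ^ n = 0 := fun n => Subsingleton.elim _ _
    simp only [this]
    exact tendsto_const_nhds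
  have hrad : spectralRadius ℂ D < (1 : ℝ≥0) := by
    refine spectrum.spectralRadius_lt_of_forall_lt D fun z hz => ?_
    by_contra hlt
    exact hz (h z (by exact_mod_cast not_lt.1 hlt))
  obtain ⟨r, hr, hr1⟩ := ENNReal.lt_iff_exists_nnreal_btwn.1 hrad
  have hev := (spectrum.pow_nnnorm_pow_one_div_tendsto_nhds_spectralRadius D).eventually_lt_const hr
  have hr1' : (r : ℝ) < 1 := by exact_mod_cast hr1
  refine squeeze_zero_norm' ?_ (tendsto_pow_atTop_nhds_zero_of_lt_one r.2 hr1')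
  filter_upwards [hev, eventually_ge_atTop 1] with n hn hn1
  have hn0 : (n : ℝ) ≠ 0 := by positivity
  have h1 := ENNReal.rpow_le_rpow hn.le (Nat.cast_nonneg n : (0 : ℝ) ≤ n)
  rw [← ENNReal.rpow_mul, one_div_mul_cancel hn0, ENNReal.rpow_one, ENNReal.rpow_natCast] at h1
  exact_mod_cast h1

/-- If `ker (1 - A)` and `range (1 - A)` are algebraic complements, and `1` is the only possible
point of the spectrum of `A` outside the open unit disc, then the powers of `A` converge in
operator norm. The limit `P` is the projection given by the decomposition, and `A - P` has its
spectrum in the open unit disc. -/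
theorem exists_tendsto_pow_of_isCompl [CompleteSpace X] {A : X →L[ℂ] X}
    (hspec : ∀ z : ℂ, 1 ≤ ‖z‖ → z ≠ 1 → IsUnit (algebraMap ℂ (X →L[ℂ] X) z - A))
    (h : IsCompl (LinearMap.ker ((1 - A : X →L[ℂ] X) : X →ₗ[ℂ] X))
      (LinearMap.range ((1 - A : X →L[ℂ] X) : X →ₗ[ℂ] X))) :
    ∃ P : X →L[ℂ] X, Tendsto (fun n : ℕ => A ^ n) atTop (𝓝 P) := by
  have htop := Submodule.IsCompl.isTopCompl_of_isClosed h (1 - A).isClosed_ker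
    (isClosed_range_of_isCompl_ker _ h)
  set P : X →L[ℂ] X := Submodule.projectionL _ _ htop
  have hPP : P * P = P := Submodule.isIdempotentElem_projectionL htop
  have hmem : ∀ x, A (P x) = P x := fun x => by
    have : P x ∈ LinearMap.ker ((1 - A : X →L[ℂ] X) : X →ₗ[ℂ] X) :=
      Submodule.projectionL_apply_mem htop x
    exact (sub_eq_zero.1 (LinearMap.mem_ker.1 this)).symm
  have hAP : A * P = P := ContinuousLinearMap.ext hmem
  have hPA' : P * (1 - A) = 0 := ContinuousLinearMap.ext fun x =>
    (Submodule.projectionL_apply_eq_zero_iff htop).2 ⟨x, rfl⟩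
  have hPA : P * A = P := by
    rw [mul_sub, mul_one, sub_eq_zero] at hPA'
    exact hPA'.symm
  have hpow := sub_pow_succ hAP hPA hPP
  have hlim : Tendsto (fun n : ℕ => (A - P) ^ n) atTop (𝓝 0) := by
    refine tendsto_pow_zero_of_isUnit_algebraMap_sub fun z hz => ?_
    rcases eq_or_ne z 1 with rfl | hz1
    · rw [map_one, ContinuousLinearMap.isUnit_iff_bijective]
      have hPP' : ∀ x, P (P x) = P x := fun x => congr($hPP x)
      have hPAx : ∀ x, P (A x) = P x := fun x => congr($hPA x)
      constructor
      · rw [injective_iff_map_eq_zero]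
        intro x hx
        have hPx : P x = 0 := by
          have := congr(P $hx)
          simpa [hPP', hPAx] using this
        have hx' : x ∈ LinearMap.ker ((1 - A : X →L[ℂ] X) : X →ₗ[ℂ] X) := by
          simpa [hPx] using hx
        rw [← (Submodule.projectionL_eq_self_iff htop x).2 hx']
        exact hPx
      · intro y
        have hy : P (y - P y) = 0 := by simp [hPP']
        obtain ⟨u, hu⟩ := (Submodule.projectionL_apply_eq_zero_iff htop).1 hy
        have hu' : u - A u = y - P y := hu
        refine ⟨u - P u + P y, ?_⟩
        have : u - P u + P y - (A (u - P u + P y) - P (u - P u + P y)) = (u - A u) + P y := by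
          simp only [map_add, map_sub, hmem, hPP']
          abel
        refine this.trans ?_
        rw [hu', sub_add_cancel]
    · have hz0 : z ≠ 0 := by
        rintro rfl
        norm_num at hz
      -- `z - (A - P)` acts as `z` on `range P` and as `z - A` on `ker P`.
      have hfac : algebraMap ℂ (X →L[ℂ] X) z - (A - P)
          = (algebraMap ℂ (X →L[ℂ] X) z - A) * (1 + (z - 1)⁻¹ • P) := by
        have hz1' : z - 1 ≠ 0 := sub_ne_zero.2 hz1
        have : (z - 1)⁻¹ * z = 1 + (z - 1)⁻¹ := by field_simp; ring
        rw [mul_add, mul_one, mul_smul_comm, sub_mul, hAP, Algebra.algebraMap_eq_smul_one,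
          smul_mul_assoc, one_mul, smul_sub, smul_smul, this, add_smul, one_smul]
        abel
      have hunit : IsUnit (1 + (z - 1)⁻¹ • P) := by
        have hz1' : z - 1 ≠ 0 := sub_ne_zero.2 hz1
        have hc : (z - 1)⁻¹ - z⁻¹ - (z - 1)⁻¹ * z⁻¹ = 0 := by field_simp; ring
        have h1 : (1 + (z - 1)⁻¹ • P) * (1 - z⁻¹ • P) = 1 := by
          have : (1 + (z - 1)⁻¹ • P) * (1 - z⁻¹ • P)
              = 1 + ((z - 1)⁻¹ - z⁻¹ - (z - 1)⁻¹ * z⁻¹) • P := by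
            simp only [add_mul, mul_sub, mul_one, one_mul, smul_mul_smul_comm, hPP, sub_smul]
            abel
          rw [this, hc, zero_smul, add_zero]
        have h2 : (1 - z⁻¹ • P) * (1 + (z - 1)⁻¹ • P) = 1 := by
          have : (1 - z⁻¹ • P) * (1 + (z - 1)⁻¹ • P)
              = 1 + ((z - 1)⁻¹ - z⁻¹ - (z - 1)⁻¹ * z⁻¹) • P := by
            simp only [sub_mul, mul_add, mul_one, one_mul, smul_mul_smul_comm, hPP, sub_smul,
              mul_comm z⁻¹]
            abel
          rw [this, hc, zero_smul, add_zero]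
        exact ⟨⟨_, _, h1, h2⟩, rfl⟩
      rw [hfac]
      exact (hspec z hz hz1).mul hunit
  refine ⟨P, (tendsto_add_atTop_iff_nat 1).1 ?_⟩
  have := ((tendsto_add_atTop_iff_nat 1).2 hlim).add_const P
  simpa [hpow] using this

end Powers

/-! ### The resolvent of the generator -/

section Resolvent

variable {X : Type*} [NormedAddCommGroup X] [NormedSpace ℂ X] {T : ℝ≥0 → X →L[ℂ] X}

/-- `R` is the resolvent `(μ - B)⁻¹` of the generator `B` of `T` at `μ`, with `B` described by
right derivatives of orbits: `R` maps into the domain of `B` with `B (R x) = μ • R x - x`, and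
`R (B x) = μ • R x - x` on that domain. -/
structure IsGeneratorResolvent (T : ℝ≥0 → X →L[ℂ] X) (μ : ℂ) (R : X →L[ℂ] X) : Prop where
  hasOrbitDeriv : ∀ x, HasOrbitDeriv T (R x) (μ • R x - x)
  apply_eq : ∀ {x y}, HasOrbitDeriv T x y → R y = μ • R x - x

theorem IsGeneratorResolvent.sub_eq {μ ν : ℂ} {R S : X →L[ℂ] X}
    (hR : IsGeneratorResolvent T μ R) (hS : IsGeneratorResolvent T ν S) :
    R - S = (ν - μ) • (R * S) := by
  ext x
  have h := hR.apply_eq (hS.hasOrbitDeriv x)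
  rw [map_sub, map_smul] at h
  have : R x - S x = ν • R (S x) - μ • R (S x) := by
    have h1 : R x = ν • R (S x) - (μ • R (S x) - S x) := by rw [← h]; abel
    rw [h1]; abel
  simpa [sub_smul] using this

/-- If `ν` is also a resolvent point, then `1 + (μ - ν) • S` inverts `1 - (μ - ν) • R`, by the
resolvent identity. -/
theorem IsGeneratorResolvent.isUnit_one_sub {μ ν : ℂ} {R S : X →L[ℂ] X}
    (hR : IsGeneratorResolvent T μ R) (hS : IsGeneratorResolvent T ν S) :
    IsUnit (1 - (μ - ν) • R) := by
  have h1 := hR.sub_eq hS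
  have h2 := hS.sub_eq hR
  refine ⟨⟨1 - (μ - ν) • R, 1 + (μ - ν) • S, ?_, ?_⟩, rfl⟩
  · have : (1 - (μ - ν) • R) * (1 + (μ - ν) • S)
        = 1 - (μ - ν) • (R - S - (ν - μ) • (R * S)) := by
      simp only [sub_mul, mul_add, mul_one, one_mul, smul_mul_smul_comm]
      module
    rw [this, ← h1, sub_self, smul_zero, sub_zero]
  · have : (1 + (μ - ν) • S) * (1 - (μ - ν) • R)
        = 1 + (μ - ν) • (S - R - (μ - ν) • (S * R)) := by
      simp only [add_mul, mul_sub, mul_one, one_mul, smul_mul_smul_comm]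
      module
    rw [this, ← h2, sub_self, smul_zero, add_zero]

/-- If `1 ≤ ‖z‖` and `z ≠ 1`, then `re z⁻¹ < 1`, so `l - l / z` lies in the right half plane and
is a resolvent point. Hence `z - l • R = z • (1 - (l / z) • R)` is invertible. -/
theorem IsGeneratorResolvent.isUnit_algebraMap_sub {l : ℝ} (hl : 0 < l) {R : X →L[ℂ] X}
    (hR : IsGeneratorResolvent T l R)
    (hex : ∀ μ : ℂ, 0 < μ.re → ∃ S, IsGeneratorResolvent T μ S) {z : ℂ} (hz : 1 ≤ ‖z‖)
    (hz1 : z ≠ 1) : IsUnit (algebraMap ℂ (X →L[ℂ] X) z - (l : ℂ) • R) := by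
  have hz0 : z ≠ 0 := by
    rintro rfl
    norm_num at hz
  have hre : (z⁻¹).re < 1 := by
    have hle : ‖z⁻¹‖ ≤ 1 := by
      rw [norm_inv]
      exact inv_le_one_of_one_le₀ hz
    refine lt_of_le_of_ne ((Complex.re_le_norm _).trans hle) fun h => hz1 ?_
    have hsq : (z⁻¹).re * (z⁻¹).re + (z⁻¹).im * (z⁻¹).im ≤ 1 := by
      rw [← Complex.normSq_apply, Complex.normSq_eq_norm_sq]
      exact pow_le_one₀ (norm_nonneg _) hle
    have him : (z⁻¹).im = 0 := by
      rw [h] at hsq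
      nlinarith [mul_self_nonneg (z⁻¹).im]
    have : z⁻¹ = 1 := Complex.ext (by simpa using h) (by simpa using him)
    simpa using this
  obtain ⟨S, hS⟩ := hex (l - l * z⁻¹) (by
    rw [Complex.sub_re, Complex.re_ofReal_mul, Complex.ofReal_re]
    nlinarith)
  have hu := hR.isUnit_one_sub hS
  have hfac : algebraMap ℂ (X →L[ℂ] X) z - (l : ℂ) • R
      = algebraMap ℂ (X →L[ℂ] X) z * (1 - ((l : ℂ) - (l - l * z⁻¹)) • R) := by
    have : z * ((l : ℂ) - (l - l * z⁻¹)) = l := by field_simp; ring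
    rw [Algebra.algebraMap_eq_smul_one, smul_mul_assoc, one_mul, smul_sub, smul_smul, this]
  rw [hfac]
  exact ((IsUnit.mk0 z hz0).map _).mul hu

theorem mem_unboundedKer_semigroupGenerator {x : X} :
    x ∈ unboundedKer (semigroupGenerator T) ↔ HasOrbitDeriv T x 0 := by
  constructor
  · rintro ⟨v, hv, rfl⟩
    have hv' : Classical.choose v.2 = 0 := hv
    exact hv' ▸ Classical.choose_spec v.2
  · intro h
    have hx : ∃ y, HasOrbitDeriv T x y := ⟨0, h⟩
    exact ⟨⟨x, hx⟩, (Classical.choose_spec hx).unique h, rfl⟩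

theorem mem_unboundedIm_semigroupGenerator {y : X} :
    y ∈ unboundedIm (semigroupGenerator T) ↔ ∃ x, HasOrbitDeriv T x y := by
  constructor
  · rintro ⟨v, rfl⟩
    exact ⟨v, Classical.choose_spec v.2⟩
  · rintro ⟨x, h⟩
    have hx : ∃ y, HasOrbitDeriv T x y := ⟨y, h⟩
    exact ⟨⟨x, hx⟩, (Classical.choose_spec hx).unique h⟩

theorem IsGeneratorResolvent.ker_one_sub_smul {μ : ℂ} {R : X →L[ℂ] X}
    (hR : IsGeneratorResolvent T μ R) :
    LinearMap.ker ((1 - μ • R : X →L[ℂ] X) : X →ₗ[ℂ] X)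
      = unboundedKer (semigroupGenerator T) := by
  ext x
  rw [mem_unboundedKer_semigroupGenerator, LinearMap.mem_ker]
  constructor
  · intro hx
    have hx' : x = μ • R x := sub_eq_zero.1 hx
    have := (hR.hasOrbitDeriv x).smul μ
    rwa [← hx', sub_self, smul_zero] at this
  · intro h
    have h0 := hR.apply_eq h
    rw [map_zero] at h0
    exact sub_eq_zero.2 (sub_eq_zero.1 h0.symm).symm

theorem IsGeneratorResolvent.range_one_sub_smul {μ : ℂ} {R : X →L[ℂ] X}
    (hR : IsGeneratorResolvent T μ R) :
    LinearMap.range ((1 - μ • R : X →L[ℂ] X) : X →ₗ[ℂ] X)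
      = unboundedIm (semigroupGenerator T) := by
  ext y
  rw [mem_unboundedIm_semigroupGenerator, LinearMap.mem_range]
  constructor
  · rintro ⟨x, rfl⟩
    refine ⟨(-1 : ℂ) • R x, ?_⟩
    convert (hR.hasOrbitDeriv x).smul (-1) using 1
    simp
  · rintro ⟨x, h⟩
    refine ⟨y - μ • x, ?_⟩
    have hy := hR.apply_eq h
    have : y - μ • x - μ • R (y - μ • x) = y := by
      rw [map_sub, map_smul, hy]
      module
    exact this

end Resolvent

/-! ### The Laplace transform of a semigroup of subexponential growth -/

section Laplace

open MeasureTheory Set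

variable {X : Type*} [NormedAddCommGroup X] [NormedSpace ℂ X] {T : ℝ≥0 → X →L[ℂ] X}

/-- A semigroup with `log ‖T t‖ / t → 0` is `O (exp (ε t))` for every `ε > 0`: the hypothesis
controls large `t`, and the uniform boundedness principle controls the bounded ones. -/
theorem IsC0Semigroup.exists_norm_le_exp [CompleteSpace X] (hT : IsC0Semigroup T)
    (hlog : Tendsto (fun t : ℝ≥0 => Real.log ‖T t‖ / (t : ℝ)) atTop (𝓝 0)) {ε : ℝ}
    (hε : 0 < ε) : ∃ M : ℝ, ∀ t : ℝ≥0, ‖T t‖ ≤ M * Real.exp (ε * t) := by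
  obtain ⟨a, ha⟩ := eventually_atTop.1
    ((hlog.eventually_lt_const hε).and (eventually_ge_atTop 1))
  obtain ⟨C, hC⟩ := banach_steinhaus (g := fun t : Icc (0 : ℝ≥0) a => T t) fun x => by
    obtain ⟨C, hC⟩ := (isCompact_Icc (a := (0 : ℝ≥0)) (b := a)).exists_bound_of_continuousOn
      (hT.continuous_orbit x).continuousOn
    exact ⟨C, fun t => hC t t.2⟩
  refine ⟨max C 1, fun t => ?_⟩
  rcases le_total t a with hta | hta
  · calc ‖T t‖ ≤ C := hC ⟨t, zero_le, hta⟩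
      _ ≤ max C 1 := le_max_left _ _
      _ ≤ max C 1 * Real.exp (ε * t) :=
        le_mul_of_one_le_right (zero_le_one.trans (le_max_right _ _))
          (Real.one_le_exp (by positivity))
  · obtain ⟨h1, h2⟩ := ha t hta
    have ht : (0 : ℝ) < t := by exact_mod_cast zero_lt_one.trans_le h2
    have hle : ‖T t‖ ≤ Real.exp (ε * t) := by
      rcases (norm_nonneg (T t)).eq_or_lt with h0 | h0
      · rw [← h0]
        positivity
      · rw [← Real.log_le_iff_le_exp h0]
        exact ((div_lt_iff₀ ht).1 h1).le
    exact hle.trans (le_mul_of_one_le_left (Real.exp_pos _).le (le_max_right _ _))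

/-- The integrand `exp (-μ s) T_s x` of the Laplace transform of an orbit of `T`. Its value at
a negative `s` plays no role. -/
noncomputable def laplaceIntegrand (T : ℝ≥0 → X →L[ℂ] X) (μ : ℂ) (x : X) (s : ℝ) : X :=
  Complex.exp (-(μ * s)) • T s.toNNReal x

theorem IsC0Semigroup.continuous_laplaceIntegrand (hT : IsC0Semigroup T) (μ : ℂ) (x : X) :
    Continuous (laplaceIntegrand T μ x) := by
  have h : Continuous fun s : ℝ => Complex.exp (-(μ * s)) := by fun_prop
  exact h.smul ((hT.continuous_orbit x).comp continuous_real_toNNReal)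

theorem norm_laplaceIntegrand_le {M ε : ℝ} (hM : ∀ t : ℝ≥0, ‖T t‖ ≤ M * Real.exp (ε * t))
    (μ : ℂ) (x : X) {s : ℝ} (hs : 0 ≤ s) :
    ‖laplaceIntegrand T μ x s‖ ≤ M * ‖x‖ * Real.exp (-(μ.re - ε) * s) := by
  have h1 : ‖T s.toNNReal x‖ ≤ M * Real.exp (ε * s) * ‖x‖ := by
    have := (T s.toNNReal).le_of_opNorm_le (hM s.toNNReal) x
    rwa [Real.coe_toNNReal s hs] at this
  rw [laplaceIntegrand, norm_smul, Complex.norm_exp]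
  calc Real.exp (-(μ * s)).re * ‖T s.toNNReal x‖
      ≤ Real.exp (-(μ * s)).re * (M * Real.exp (ε * s) * ‖x‖) := by gcongr
    _ = M * ‖x‖ * (Real.exp (-(μ * s)).re * Real.exp (ε * s)) := by ring
    _ = M * ‖x‖ * Real.exp (-(μ.re - ε) * s) := by
      rw [← Real.exp_add]
      congr 2
      simp
      ring

theorem IsC0Semigroup.integrableOn_laplaceIntegrand (hT : IsC0Semigroup T) {M ε : ℝ}
    (hM : ∀ t : ℝ≥0, ‖T t‖ ≤ M * Real.exp (ε * t)) {μ : ℂ} (hμ : ε < μ.re) (x : X) :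
    IntegrableOn (laplaceIntegrand T μ x) (Ioi 0) := by
  refine Integrable.mono' ((exp_neg_integrableOn_Ioi 0 (sub_pos.2 hμ)).const_mul (M * ‖x‖))
    (hT.continuous_laplaceIntegrand μ x).aestronglyMeasurable ?_
  filter_upwards [ae_restrict_mem measurableSet_Ioi] with s hs
  exact norm_laplaceIntegrand_le hM μ x (le_of_lt hs)

/-- Pushing the Laplace transform of an orbit along the semigroup shifts the integrand. -/
theorem IsC0Semigroup.map_integral_laplaceIntegrand [CompleteSpace X] (hT : IsC0Semigroup T)
    {μ : ℂ} {x : X} (hint : IntegrableOn (laplaceIntegrand T μ x) (Ioi 0)) (t : ℝ≥0) :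
    T t (∫ s in Ioi (0 : ℝ), laplaceIntegrand T μ x s)
      = Complex.exp (μ * (t : ℝ)) • ((∫ s in Ioi (0 : ℝ), laplaceIntegrand T μ x s)
        - ∫ s in (0 : ℝ)..t, laplaceIntegrand T μ x s) := by
  have hshift : ∀ s ∈ Ioi (0 : ℝ), T t (laplaceIntegrand T μ x s)
      = Complex.exp (μ * (t : ℝ)) • laplaceIntegrand T μ x (s + t) := fun s hs => by
    have hst : (s + t).toNNReal = t + s.toNNReal := by
      rw [Real.toNNReal_add (le_of_lt hs) t.coe_nonneg, Real.toNNReal_coe, add_comm]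
    rw [laplaceIntegrand, laplaceIntegrand, hst, hT.map_add, map_smul, smul_smul,
      ← Complex.exp_add, mul_apply_eq_comp]
    congr 2
    push_cast
    ring
  rw [← ContinuousLinearMap.integral_comp_comm _ hint,
    setIntegral_congr_fun measurableSet_Ioi hshift, integral_smul]
  congr 1
  have hcomp : ∫ s in Ioi (0 : ℝ), laplaceIntegrand T μ x (s + t)
      = ∫ s in Ioi (t : ℝ), laplaceIntegrand T μ x s := by
    have := (measurePreserving_add_right volume (t : ℝ)).setIntegral_preimage_emb
      (MeasurableEquiv.addRight (t : ℝ)).measurableEmbedding (laplaceIntegrand T μ x) (Ioi (t : ℝ))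
    simpa using this
  rw [hcomp, eq_sub_iff_add_eq', intervalIntegral.integral_interval_add_Ioi hint
    (hint.mono_set (Ioi_subset_Ioi t.coe_nonneg))]

/-- For `0 < re μ` the Laplace transform `x ↦ ∫₀^∞ exp (-μ s) T_s x ds` is a bounded operator,
and it is the resolvent of the generator at `μ`. -/
theorem IsC0Semigroup.exists_isGeneratorResolvent [CompleteSpace X] (hT : IsC0Semigroup T)
    (hlog : Tendsto (fun t : ℝ≥0 => Real.log ‖T t‖ / (t : ℝ)) atTop (𝓝 0)) {μ : ℂ}
    (hμ : 0 < μ.re) :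
    ∃ R : X →L[ℂ] X, IsGeneratorResolvent T μ R ∧
      ∀ x, Tendsto (fun b : ℝ => ∫ s in (0 : ℝ)..b, laplaceIntegrand T μ x s) atTop
        (𝓝 (R x)) := by
  obtain ⟨M, hM⟩ := hT.exists_norm_le_exp hlog (half_pos hμ)
  have hint := hT.integrableOn_laplaceIntegrand hM (half_lt_self hμ)
  have hexp : IntegrableOn (fun s : ℝ => Real.exp (-(μ.re - μ.re / 2) * s)) (Ioi 0) :=
    exp_neg_integrableOn_Ioi 0 (sub_pos.2 (half_lt_self hμ))
  let R₀ : X →ₗ[ℂ] X :=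
    { toFun := fun x => ∫ s in Ioi (0 : ℝ), laplaceIntegrand T μ x s
      map_add' := fun x y => by
        rw [← integral_add (hint x) (hint y)]
        simp [laplaceIntegrand]
      map_smul' := fun c x => by
        rw [RingHom.id_apply, ← integral_smul]
        simp only [laplaceIntegrand, map_smul, smul_comm c] }
  let R : X →L[ℂ] X := R₀.mkContinuous
    (M * ∫ s in Ioi (0 : ℝ), Real.exp (-(μ.re - μ.re / 2) * s)) fun x => by
      have h := norm_integral_le_of_norm_le (hexp.const_mul (M * ‖x‖))
        ((ae_restrict_mem measurableSet_Ioi).mono fun s hs =>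
          norm_laplaceIntegrand_le hM μ x (le_of_lt hs))
      rw [integral_const_mul] at h
      exact h.trans_eq (by ring)
  have hR : ∀ x, R x = ∫ s in Ioi (0 : ℝ), laplaceIntegrand T μ x s := fun x => rfl
  have hderiv : ∀ x, HasOrbitDeriv T (R x) (μ • R x - x) := fun x => by
    have hcont := hT.continuous_laplaceIntegrand μ x
    have h1 : HasDerivAt (fun t : ℝ => R x - ∫ s in (0 : ℝ)..t, laplaceIntegrand T μ x s)
        (-x) 0 := by
      have := (hcont.integral_hasStrictDerivAt 0 0).hasDerivAt.const_sub (R x)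
      simpa [laplaceIntegrand, hT.map_zero] using this
    have h2 : HasDerivAt (fun t : ℝ => Complex.exp (μ * t)) μ 0 := by
      have := ((Complex.ofRealCLM.hasDerivAt (x := (0 : ℝ))).const_mul μ).cexp
      simpa using this
    have h3 := h2.smul h1
    have h4 := h3.tendsto_slope_zero
    have hcoe : Tendsto ((↑) : ℝ≥0 → ℝ) (𝓝[>] 0) (𝓝[≠] 0) := by
      refine tendsto_nhdsWithin_iff.2 ⟨?_, ?_⟩
      · exact (NNReal.continuous_coe.tendsto 0).mono_left nhdsWithin_le_nhds
      · filter_upwards [self_mem_nhdsWithin] with t ht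
        exact (NNReal.coe_pos.2 ht).ne'
    have h5 := h4.comp hcoe
    have hlim : μ • R x - x = Complex.exp (μ * (0 : ℝ)) • (-x)
        + μ • (R x - ∫ s in (0 : ℝ)..0, laplaceIntegrand T μ x s) := by
      simp
      abel
    rw [HasOrbitDeriv, hlim]
    refine h5.congr fun t => ?_
    have hpush := hT.map_integral_laplaceIntegrand (hint x) t
    rw [← hR] at hpush
    simp [hpush]
  have hcomm : ∀ t x, R (T t x) = T t (R x) := fun t x => by
    rw [hR, hR, ← ContinuousLinearMap.integral_comp_comm _ (hint x)]
    congr 1 with s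
    rw [laplaceIntegrand, laplaceIntegrand, map_smul, ← mul_apply_eq_comp, ← mul_apply_eq_comp,
      ← hT.map_add, ← hT.map_add, add_comm]
  refine ⟨R, ⟨hderiv, fun {x y} hxy => ?_⟩, fun x => ?_⟩
  · refine HasOrbitDeriv.unique (T := T) (x := R x) ?_ (hderiv x)
    refine ((R.continuous.tendsto y).comp hxy).congr fun t => ?_
    rw [Function.comp_apply, ← hcomm, ← map_sub, R.map_smul_of_tower]
  · exact intervalIntegral_tendsto_integral_Ioi 0 (hint x) tendsto_id

end Laplace

/-! ### Abel averages -/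

section Abel

variable {X : Type*} [NormedAddCommGroup X] [NormedSpace ℂ X] {T : ℝ≥0 → X →L[ℂ] X}

theorem isAbelAverage_abelAverage {l : ℝ} {A : X →L[ℂ] X} (h : IsAbelAverage T l A) :
    IsAbelAverage T l (abelAverage T l) := by
  have hex : ∃ A, IsAbelAverage T l A := ⟨A, h⟩
  rw [abelAverage, dif_pos hex]
  exact Classical.choose_spec hex

theorem IsAbelAverage.eq_abelAverage {l : ℝ} {A : X →L[ℂ] X} (h : IsAbelAverage T l A) :
    A = abelAverage T l :=
  ContinuousLinearMap.ext fun x => tendsto_nhds_unique (h x) (isAbelAverage_abelAverage h x)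

theorem IsC0Semigroup.exists_isGeneratorResolvent_isAbelAverage [CompleteSpace X]
    (hT : IsC0Semigroup T)
    (hlog : Tendsto (fun t : ℝ≥0 => Real.log ‖T t‖ / (t : ℝ)) atTop (𝓝 0)) {l : ℝ}
    (hl : 0 < l) :
    ∃ R : X →L[ℂ] X, IsGeneratorResolvent T l R ∧ IsAbelAverage T l ((l : ℂ) • R) := by
  obtain ⟨R, hR, hlim⟩ := hT.exists_isGeneratorResolvent hlog (μ := l) (by simpa using hl)
  refine ⟨R, hR, fun x => ?_⟩
  have h := (hlim x).const_smul l
  have hval : ((l : ℂ) • R) x = l • R x := by simp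
  rw [hval]
  refine h.congr fun b => ?_
  congr 2 with s
  rw [laplaceIntegrand, ← Complex.ofReal_mul, ← Complex.ofReal_neg, ← Complex.ofReal_exp,
    Complex.coe_smul]

end Abel

/-- The first conjunct says that the Abel averages are well defined for every positive parameter. -/
theorem corollary2p4 {X : Type*} [NormedAddCommGroup X] [NormedSpace ℂ X] [CompleteSpace X]
    (T : ℝ≥0 → X →L[ℂ] X) (hT : IsC0Semigroup T)
    (hlog : Tendsto (fun t : ℝ≥0 => Real.log ‖T t‖ / (t : ℝ)) atTop (𝓝 0)) :
    (∀ l : ℝ, 0 < l → IsAbelAverage T l (abelAverage T l)) ∧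
    [IsCompl (unboundedKer (semigroupGenerator T)) (unboundedIm (semigroupGenerator T)),
      ∃ l : ℝ, 0 < l ∧ ∃ P : X →L[ℂ] X,
        Tendsto (fun n : ℕ => abelAverage T l ^ n) atTop (𝓝 P),
      ∀ l : ℝ, 0 < l → ∃ P : X →L[ℂ] X,
        Tendsto (fun n : ℕ => abelAverage T l ^ n) atTop (𝓝 P)].TFAE ∧
    ∀ l : ℝ, 0 < l → ∀ P : X →L[ℂ] X,
      Tendsto (fun n : ℕ => abelAverage T l ^ n) atTop (𝓝 P) →
        IsProjectionOntoAlong P (unboundedKer (semigroupGenerator T))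
          (unboundedIm (semigroupGenerator T)) := by
  have hproj : ∀ l : ℝ, 0 < l → ∀ P : X →L[ℂ] X,
      Tendsto (fun n : ℕ => abelAverage T l ^ n) atTop (𝓝 P) →
        IsProjectionOntoAlong P (unboundedKer (semigroupGenerator T))
          (unboundedIm (semigroupGenerator T)) := by
    intro l hl P hP
    obtain ⟨R, hR, hA⟩ := hT.exists_isGeneratorResolvent_isAbelAverage hlog hl
    rw [← hA.eq_abelAverage] at hP
    rw [← hR.ker_one_sub_smul, ← hR.range_one_sub_smul]
    exact isProjectionOntoAlong_of_tendsto_pow hP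
  refine ⟨fun l hl => ?_, ?_, hproj⟩
  · obtain ⟨R, -, hA⟩ := hT.exists_isGeneratorResolvent_isAbelAverage hlog hl
    exact isAbelAverage_abelAverage hA
  tfae_have 1 → 3 := fun hcompl l hl => by
    obtain ⟨R, hR, hA⟩ := hT.exists_isGeneratorResolvent_isAbelAverage hlog hl
    rw [← hA.eq_abelAverage]
    rw [← hR.ker_one_sub_smul, ← hR.range_one_sub_smul] at hcompl
    refine exists_tendsto_pow_of_isCompl (fun z hz hz1 => ?_) hcompl
    exact hR.isUnit_algebraMap_sub hl
      (fun μ hμ => (hT.exists_isGeneratorResolvent hlog hμ).imp fun _ h => h.1) hz hz1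
  tfae_have 3 → 2 := fun h => ⟨1, one_pos, h 1 one_pos⟩
  tfae_have 2 → 1 := fun ⟨l, hl, P, hP⟩ => by
    have h := hproj l hl P hP
    rw [← h.range_eq, ← h.ker_eq]
    exact (ContinuousLinearMap.IsIdempotentElem.isTopCompl h.idempotent).isCompl
  tfae_finish
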